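/- There is an absolute constant $C>0$ such that for every finite simple graph $G$ with $m$ edges and no isolated vertices, the number $w(G)$ exists and satisfies $w(G)\le Cm$. Here $K_N$ is the complete graph on $N$ vertices, and $w(G)$ is the least $N_0$ such that for every $N\ge N_0$ and every map $f:E(K_N)\to E(K_N)$ with $f(e)\cap e=\emptyset$ for all $e\in E(K_N)$, there is a subgraph $G^*$ of $K_N$ isomorphic to $G$ such that $f(e)\cap V(G^*)=\emptyset$ for all $e\in E(G^*)$. -/

import Mathlib

/-- A map `f : E(K_N) → E(K_N)` such that `f e` and `e` are disjoint for every edge `e` of the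
complete graph `K_N` on `Fin N`. -/
def IsDisjointEdgeMap {N : ℕ}
    (f : (⊤ : SimpleGraph (Fin N)).edgeSet → (⊤ : SimpleGraph (Fin N)).edgeSet) : Prop :=
  ∀ e : (⊤ : SimpleGraph (Fin N)).edgeSet,
    ∀ v ∈ (f e : Sym2 (Fin N)), v ∉ (e : Sym2 (Fin N))

/-- The copy `H` of a graph in `K_N` is free for `f`: for every edge `e` of `H`, no vertex of `H`
lies on the edge `f e`. -/
def IsFreeSubgraph {N : ℕ}
    (f : (⊤ : SimpleGraph (Fin N)).edgeSet → (⊤ : SimpleGraph (Fin N)).edgeSet)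
    (H : (⊤ : SimpleGraph (Fin N)).Subgraph) : Prop :=
  ∀ e : (⊤ : SimpleGraph (Fin N)).edgeSet, (e : Sym2 (Fin N)) ∈ H.edgeSet →
    ∀ v ∈ (f e : Sym2 (Fin N)), v ∉ H.verts

/-- Every `f : E(K_N) → E(K_N)` with `f e` disjoint from `e` for all `e` admits a free copy
of `G` in `K_N`. -/
def ForcesFreeCopy {V : Type*} (G : SimpleGraph V) (N : ℕ) : Prop :=
  ∀ f : (⊤ : SimpleGraph (Fin N)).edgeSet → (⊤ : SimpleGraph (Fin N)).edgeSet,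
    IsDisjointEdgeMap f →
      ∃ H : (⊤ : SimpleGraph (Fin N)).Subgraph, Nonempty (G ≃g H.coe) ∧ IsFreeSubgraph f H

/-- The numbers from which on every complete graph forces a free copy of `G`. For `N = 2` and
`N = 3` there is no map `f` as above at all, so `ForcesFreeCopy G N` holds vacuously there; asking
for all `M ≥ N` discards these meaningless values. (For `N ≥ 4` the property `ForcesFreeCopy G N`
passes from `N` to `N + 1`, so nothing else changes.) -/
def forcingThresholds {V : Type*} (G : SimpleGraph V) : Set ℕ :=
  {N | ∀ M, N ≤ M → ForcesFreeCopy G M}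

/-- The parameter `w(G)`: the least `N` from which on every complete graph forces a free copy
of `G`. -/
noncomputable def wParam {V : Type*} (G : SimpleGraph V) : ℕ :=
  sInf (forcingThresholds G)

/-! Vertices are embedded greedily in order of decreasing degree, so that the degree of vertex `i`
times `i` is at most `2m`. A new image `y` must avoid the values of `f` on edges already embedded,
and, for each embedded neighbour `a`, every `y` for which `f(ya)` meets the current image `X`. If
the sum of `hitCount` `d(a, b)` over `b ∈ X` is `O(|X|)` for every `a ∈ X`, only `O(m)` points are
excluded. This bound is preserved by a barrier argument: `IsBalanced` controls the sum of reciprocal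
gaps, and by `IsBalanced.exists_insert` some choice of `y` keeps it small, since each gap grows on
average. -/

/-! ### Balanced sets and the barrier potential -/

open Finset in
/-- Markov's inequality for counting. -/
theorem card_filter_lt_mul_le {α : Type*} (s : Finset α) (w : α → ℝ) (hw : ∀ a ∈ s, 0 ≤ w a)
    (c : ℝ) : (#{a ∈ s | c < w a} : ℝ) * c ≤ ∑ a ∈ s, w a := by
  calc (#{a ∈ s | c < w a} : ℝ) * c = ∑ a ∈ s with c < w a, c := by simp
    _ ≤ ∑ a ∈ s with c < w a, w a :=
        sum_le_sum fun a ha => (mem_filter.1 ha).2.le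
    _ ≤ ∑ a ∈ s, w a :=
        sum_le_sum_of_subset_of_nonneg (filter_subset _ _) fun a ha _ => hw a ha

/-- A set `X` is balanced for the weight `d` if the columns of `X` have average weight at most `32`,
and the gaps `1024 |X| - d(a, X)`, for `a ∈ X`, are positive with reciprocals summing to at most
`1 / 64`. -/
structure IsBalanced {α : Type*} [Fintype α] (d : α → α → ℝ) (X : Finset α) : Prop where
  col_le : ∀ b ∈ X, ∑ a, d a b ≤ 32 * Fintype.card α
  gap_pos : ∀ a ∈ X, 0 < 1024 * (X.card : ℝ) - ∑ b ∈ X, d a b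
  sum_inv_gap_le : ∑ a ∈ X, (1024 * (X.card : ℝ) - ∑ b ∈ X, d a b)⁻¹ ≤ 1 / 64

theorem isBalanced_empty {α : Type*} [Fintype α] (d : α → α → ℝ) : IsBalanced d ∅ :=
  ⟨by simp, by simp, by simp⟩

open Finset in
/-- The reciprocals of the gaps do not grow on average when a random point is added: the gap grows
by `1024` and shrinks by a weight with bounded mean. -/
theorem sum_inv_gap_add_sub_le {α : Type*} (s : Finset α) (w : α → ℝ) (hw : ∀ y ∈ s, 0 ≤ w y)
    {g N : ℝ} (hg : 64 ≤ g) (hwg : ∀ y ∈ s, w y ≤ g / 2) (hs : N / 2 ≤ #s)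
    (hsum : ∑ y ∈ s, w y ≤ 2 * N) :
    ∑ y ∈ s, (g + 1024 - w y)⁻¹ ≤ #s * (g⁻¹ - 59 * (g⁻¹) ^ 2) := by
  have hg0 : 0 < g := by linarith
  -- A bound linear in `w y`, valid because `w y ≤ g / 2`; after it only the mean of `w`, at most
  -- `4`, matters.
  have hpt : ∀ y ∈ s, (g + 1024 - w y)⁻¹ ≤ (g + 1024)⁻¹ + 2 * w y * (g⁻¹ * (g + 1024)⁻¹) := by
    intro y hy
    have h1 := hw y hy
    have h2 := hwg y hy
    have h3 : 0 < g + 1024 - w y := by linarith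
    have h4 : 0 < g + 1024 := by linarith
    have : (g + 1024)⁻¹ + 2 * w y * (g⁻¹ * (g + 1024)⁻¹) = (g + 2 * w y) / (g * (g + 1024)) := by
      field_simp
    rw [this, inv_eq_one_div, div_le_div_iff₀ h3 (by positivity)]
    nlinarith
  have hu : 0 < g⁻¹ := by positivity
  -- `17 = (64 + 1024) / 64`; the final `59` comes from `1016 / 17 > 59`.
  have h17 : g⁻¹ ≤ 17 * (g + 1024)⁻¹ := by
    rw [inv_eq_one_div, ← div_eq_mul_inv, div_le_div_iff₀ hg0 (by linarith)]
    linarith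
  have hdiff : (g + 1024)⁻¹ = g⁻¹ - 1024 * (g⁻¹ * (g + 1024)⁻¹) := by
    field_simp
    ring
  set h := (g + 1024)⁻¹
  have hh0 : 0 < h := by positivity
  calc ∑ y ∈ s, (g + 1024 - w y)⁻¹ ≤ ∑ y ∈ s, (h + 2 * w y * (g⁻¹ * h)) := sum_le_sum hpt
    _ = #s * h + 2 * (∑ y ∈ s, w y) * (g⁻¹ * h) := by
        rw [sum_add_distrib, ← sum_mul, ← mul_sum]; simp
    _ ≤ #s * h + 8 * #s * (g⁻¹ * h) := by
        have : 0 ≤ g⁻¹ * h := by positivity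
        nlinarith
    _ = #s * (g⁻¹ - 1016 * (g⁻¹ * h)) := by
        rw [show #s * h = #s * (g⁻¹ - 1024 * (g⁻¹ * h)) by rw [← hdiff]]; ring
    _ ≤ #s * (g⁻¹ - 59 * (g⁻¹) ^ 2) := by
        apply mul_le_mul_of_nonneg_left _ (Nat.cast_nonneg _)
        nlinarith [mul_le_mul_of_nonneg_left h17 hu.le, mul_pos hu hh0]

open Finset in
/-- A balanced set can be extended by a point outside any prescribed set containing at most a
quarter of all points. -/
theorem IsBalanced.exists_insert {α : Type*} [Fintype α] [DecidableEq α] {d : α → α → ℝ}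
    (hd : ∀ a b, 0 ≤ d a b) (hdiag : ∀ a, d a a = 0)
    (hrow : ∀ a, ∑ b, d a b ≤ 2 * Fintype.card α) {X : Finset α} (hX : IsBalanced d X)
    (F : Finset α) (hXF : X ⊆ F) (hF : 4 * #F ≤ Fintype.card α) (hα : 0 < Fintype.card α) :
    ∃ y, y ∉ F ∧ IsBalanced d (insert y X) := by
  obtain ⟨hcol, hgap, hS⟩ := hX
  set N : ℝ := (Fintype.card α : ℝ) with hN
  have hN0 : 0 < N := by rw [hN]; exact_mod_cast hα
  set i : ℝ := (#X : ℝ) with hi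
  have hi0 : 0 ≤ i := by positivity
  set g : α → ℝ := fun a => 1024 * i - ∑ b ∈ X, d a b with hgdef
  change ∀ a ∈ X, 0 < g a at hgap
  change ∑ a ∈ X, (g a)⁻¹ ≤ 1 / 64 at hS
  set S : ℝ := ∑ a ∈ X, (g a)⁻¹ with hSdef
  have hg64 : ∀ a ∈ X, 64 ≤ g a := by
    intro a ha
    have h1 : (g a)⁻¹ ≤ 1 / 64 :=
      (single_le_sum (f := fun a => (g a)⁻¹) (fun b hb => (inv_pos.2 (hgap b hb)).le) ha).trans hS
    rw [inv_eq_one_div, div_le_div_iff₀ (hgap a ha) (by norm_num)] at h1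
    linarith
  -- Three kinds of bad points: heavy column, heavy row over `X`, large damage to an existing gap.
  -- By Markov each has at most `N / 16` points, so together with `F` they fill less than half.
  set B₁ : Finset α := {y | 32 * N < ∑ a, d a y} with hB₁
  set B₂ : Finset α := {y | 512 * (i + 1) < ∑ b ∈ X, d y b} with hB₂
  set B₃ : Finset α := X.biUnion fun a => {y | g a / 2 < d a y} with hB₃
  have hB₁c : (#B₁ : ℝ) ≤ N / 16 := by
    have h1 := card_filter_lt_mul_le univ (fun y => ∑ a, d a y)
      (fun y _ => sum_nonneg fun a _ => hd a y) (32 * N)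
    have h2 : ∑ y, ∑ a, d a y ≤ N * (2 * N) := by
      rw [sum_comm]
      refine (sum_le_sum fun a _ => hrow a).trans ?_
      simp [hN]
    have h3 : (#B₁ : ℝ) * (32 * N) ≤ N * (2 * N) := h1.trans h2
    nlinarith
  have hB₂c : (#B₂ : ℝ) ≤ N / 16 := by
    have h1 := card_filter_lt_mul_le univ (fun y => ∑ b ∈ X, d y b)
      (fun y _ => sum_nonneg fun b _ => hd y b) (512 * (i + 1))
    have h2 : ∑ y, ∑ b ∈ X, d y b ≤ i * (32 * N) := by
      rw [sum_comm]
      refine (sum_le_sum fun b hb => hcol b hb).trans ?_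
      simp [hi]
    have h3 : (#B₂ : ℝ) * (512 * (i + 1)) ≤ i * (32 * N) := h1.trans h2
    nlinarith
  have hB₃c : (#B₃ : ℝ) ≤ N / 16 := by
    have h1 : (#B₃ : ℝ) ≤ ∑ a ∈ X, (#{y | g a / 2 < d a y} : ℝ) := by
      exact_mod_cast card_biUnion_le
    have h2 : ∀ a ∈ X, (#{y | g a / 2 < d a y} : ℝ) ≤ 4 * N * (g a)⁻¹ := by
      intro a ha
      have h3 := (card_filter_lt_mul_le univ (fun y => d a y) (fun y _ => hd a y) (g a / 2)).trans
        (hrow a)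
      rw [← div_eq_mul_inv, le_div_iff₀ (hgap a ha)]
      linarith
    have h4 := h1.trans (sum_le_sum h2)
    rw [← mul_sum] at h4
    nlinarith
  set s : Finset α := univ \ (F ∪ (B₁ ∪ (B₂ ∪ B₃))) with hs
  have hsc : N / 2 ≤ #s := by
    have h1 : (#(univ : Finset α) : ℝ) ≤ #s + #(F ∪ (B₁ ∪ (B₂ ∪ B₃))) := by
      have := card_le_card_sdiff_add_card (t := F ∪ (B₁ ∪ (B₂ ∪ B₃))) (s := (univ : Finset α))
      exact_mod_cast this
    have h2 : (#(F ∪ (B₁ ∪ (B₂ ∪ B₃))) : ℝ) ≤ #F + (#B₁ + (#B₂ + #B₃)) := by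
      have := (card_union_le F (B₁ ∪ (B₂ ∪ B₃))).trans (add_le_add_right
        ((card_union_le B₁ (B₂ ∪ B₃)).trans (add_le_add_right (card_union_le B₂ B₃) _)) _)
      exact_mod_cast this
    have h3 : 4 * (#F : ℝ) ≤ N := by rw [hN]; exact_mod_cast hF
    rw [card_univ] at h1
    linarith
  have hsmem : ∀ y ∈ s, y ∉ F ∧ ∑ a, d a y ≤ 32 * N ∧ ∑ b ∈ X, d y b ≤ 512 * (i + 1) ∧
      ∀ a ∈ X, d a y ≤ g a / 2 := by
    intro y hy
    simpa [hs, hB₁, hB₂, hB₃] using hy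
  have hs0 : (0 : ℝ) < #s := by linarith
  have hsne : s.Nonempty := by
    rw [← card_pos]; exact_mod_cast hs0
  have havg : ∑ y ∈ s, ∑ a ∈ X, (g a + 1024 - d a y)⁻¹ ≤
      ∑ y ∈ s, (S - 59 * ∑ a ∈ X, ((g a)⁻¹) ^ 2) := by
    rw [sum_comm, sum_const, nsmul_eq_mul, hSdef, mul_sum, ← sum_sub_distrib, mul_sum]
    refine sum_le_sum fun a ha => ?_
    refine sum_inv_gap_add_sub_le s (d a) (fun y _ => hd a y) (hg64 a ha)
      (fun y hy => (hsmem y hy).2.2.2 a ha) hsc ?_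
    exact (sum_le_sum_of_subset_of_nonneg (subset_univ _) fun y _ _ => hd a y).trans (hrow a)
  obtain ⟨y, hy, hyS⟩ := exists_le_of_sum_le hsne havg
  obtain ⟨hyF, hy1, hy2, hy3⟩ := hsmem y hy
  have hyX : y ∉ X := fun h => hyF (hXF h)
  have hcard : (#(insert y X) : ℝ) = i + 1 := by rw [card_insert_of_notMem hyX]; simp [hi]
  have hgapy : 512 * (i + 1) ≤ 1024 * (i + 1) - ∑ b ∈ insert y X, d y b := by
    rw [sum_insert hyX, hdiag]; linarith
  have hgapa : ∀ a, 1024 * (i + 1) - ∑ b ∈ insert y X, d a b = g a + 1024 - d a y := by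
    intro a
    rw [sum_insert hyX, hgdef]; ring
  refine ⟨y, hyF, ?_, ?_, ?_⟩
  · intro b hb
    rcases mem_insert.1 hb with rfl | hb
    · exact hy1
    · exact hcol b hb
  · intro a ha
    rw [hcard]
    rcases mem_insert.1 ha with rfl | ha
    · linarith
    · rw [hgapa]
      linarith [hy3 a ha, hgap a ha]
  · rw [hcard, sum_insert hyX]
    simp only [hgapa] at hgapy ⊢
    have h1 : (g y + 1024 - d y y)⁻¹ ≤ (512 * (i + 1))⁻¹ := inv_anti₀ (by positivity) hgapy
    have hCS : S ^ 2 ≤ i * ∑ a ∈ X, ((g a)⁻¹) ^ 2 := sq_sum_le_card_mul_sum_sq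
    set Q := ∑ a ∈ X, ((g a)⁻¹) ^ 2
    have hQ0 : 0 ≤ Q := sum_nonneg fun _ _ => sq_nonneg _
    have hS0 : 0 ≤ S := sum_nonneg fun a ha => (inv_pos.2 (hgap a ha)).le
    set r := (i + 1)⁻¹ with hr
    have hr0 : 0 < r := by positivity
    have hr1 : r * (i + 1) = 1 := inv_mul_cancel₀ (by positivity)
    have hr2 : r ≤ 1 := inv_le_one_of_one_le₀ (by linarith)
    have h2 : (512 * (i + 1))⁻¹ = r / 512 := by rw [mul_inv]; ring
    have hQr : r * S ^ 2 ≤ Q := by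
      calc r * S ^ 2 ≤ r * ((i + 1) * Q) := mul_le_mul_of_nonneg_left (by linarith) hr0.le
        _ = Q := by rw [← mul_assoc, hr1, one_mul]
    -- The new point adds at most `r / 512`. Either `S` is small enough to absorb this, or
    -- Cauchy–Schwarz makes the drop `59 * Q ≥ 59 * r / 128 ^ 2` exceed it.
    have h3 : S - 59 * Q + r / 512 ≤ 1 / 64 := by
      rcases le_total S (1 / 128) with h | h
      · linarith
      · have : (1 / 128) ^ 2 ≤ S ^ 2 := by gcongr
        nlinarith
    linarith

/-! ### Greedy embedding -/

open Finset in
/-- The number of points `y` for which `φ y a` contains `b`. -/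
def hitCount {α : Type*} [Fintype α] [DecidableEq α] (φ : α → α → Finset α) (a b : α) : ℝ :=
  #{y | b ∈ φ y a}

-- Double counting of pairs `(b, y)`: each `y` contributes at most two values of `b`.
open Finset in
theorem sum_hitCount_le {α : Type*} [Fintype α] [DecidableEq α] {φ : α → α → Finset α}
    (hφ : ∀ a b, #(φ a b) ≤ 2) (a : α) : ∑ b, hitCount φ a b ≤ 2 * Fintype.card α := by
  have h := sum_card_bipartiteAbove_eq_sum_card_bipartiteBelow (s := (univ : Finset α))
    (t := (univ : Finset α)) (fun b y => b ∈ φ y a)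
  have h2 : ∑ y, #(bipartiteBelow (fun b y => b ∈ φ y a) univ y) ≤ ∑ _y : α, 2 := by
    refine sum_le_sum fun y _ => ?_
    simpa [bipartiteBelow] using hφ y a
  rw [← h] at h2
  simp only [bipartiteAbove, sum_const, card_univ, smul_eq_mul] at h2
  unfold hitCount
  rw [mul_comm]
  exact_mod_cast h2

open Finset in
/-- Greedy embedding of a graph on an initial segment of `ℕ`, given by its backward adjacency
relation `R`, into `α` such that the image of every edge is mapped by `φ` outside the image of all
vertices. -/
theorem exists_free_embedding {α : Type*} [Fintype α] [DecidableEq α] {φ : α → α → Finset α}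
    (hφ : ∀ a b, #(φ a b) ≤ 2) (hφl : ∀ a b, a ∉ φ a b) (hφr : ∀ a b, b ∉ φ a b)
    (R : ℕ → ℕ → Prop) [DecidableRel R] (D : ℕ → ℕ) {n M : ℕ} (hM : 0 < M) (hnM : n ≤ M)
    (hR : ∀ i < n, #{j ∈ range i | R i j} ≤ D i) (hDi : ∀ i < n, D i * i ≤ M)
    (hD : ∑ i ∈ range n, D i ≤ M) (hα : 4108 * M ≤ Fintype.card α) :
    ∀ i ≤ n, ∃ x : ℕ → α, Set.InjOn x (range i) ∧
      IsBalanced (hitCount φ) ((range i).image x) ∧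
      ∀ p < i, ∀ q < p, R p q → ∀ k < i, x k ∉ φ (x p) (x q) := by
  have hα0 : 0 < Fintype.card α := by omega
  intro i
  induction i with
  | zero =>
    intro _
    obtain ⟨a⟩ := Fintype.card_pos_iff.1 hα0
    exact ⟨fun _ => a, by simp, by simpa using isBalanced_empty _, by simp⟩
  | succ i ih =>
    intro hi
    obtain ⟨x, hinj, hbal, hfree⟩ := ih (by omega)
    set X := (range i).image x with hX
    have hXc : #X = i := by rw [hX, card_image_of_injOn hinj, card_range]
    -- `F₁` protects old edges from the new vertex, `F₂` new edges from the old vertices.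
    set F₁ : Finset α :=
      (range i).biUnion fun p => {q ∈ range p | R p q}.biUnion fun q => φ (x p) (x q) with hF₁
    set F₂ : Finset α :=
      {j ∈ range i | R i j}.biUnion fun j => X.biUnion fun b => {y | b ∈ φ y (x j)} with hF₂
    have hF₁c : #F₁ ≤ 2 * M := by
      calc #F₁ ≤ ∑ p ∈ range i, D p * 2 := by
            refine card_biUnion_le.trans (sum_le_sum fun p hp => ?_)
            refine (card_biUnion_le_card_mul _ _ 2 fun q _ => hφ _ _).trans ?_
            exact Nat.mul_le_mul_right _ (hR p (by have := mem_range.1 hp; omega))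
        _ ≤ ∑ p ∈ range n, D p * 2 :=
            sum_le_sum_of_subset (range_subset_range.2 (by omega))
        _ ≤ 2 * M := by rw [← sum_mul]; omega
    have hF₂c : #F₂ ≤ 1024 * M := by
      have h1 : ∀ j ∈ ({j ∈ range i | R i j} : Finset ℕ),
          #(X.biUnion fun b => ({y | b ∈ φ y (x j)} : Finset α)) ≤ 1024 * i := by
        intro j hj
        refine card_biUnion_le.trans ?_
        have h2 := hbal.gap_pos (x j) (mem_image_of_mem _ (mem_filter.1 hj).1)
        rw [hXc] at h2
        have h3 : ∑ b ∈ X, hitCount φ (x j) b ≤ 1024 * i := by linarith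
        unfold hitCount at h3
        exact_mod_cast h3
      calc #F₂ ≤ #{j ∈ range i | R i j} * (1024 * i) := card_biUnion_le_card_mul _ _ _ h1
        _ ≤ D i * (1024 * i) := Nat.mul_le_mul_right _ (hR i (by omega))
        _ = 1024 * (D i * i) := by ring
        _ ≤ 1024 * M := Nat.mul_le_mul_left _ (hDi i (by omega))
    -- `4108 = 4 * (1 + 2 + 1024)`, from the bounds on `X`, `F₁` and `F₂`.
    have hFc : 4 * #(X ∪ (F₁ ∪ F₂)) ≤ Fintype.card α := by
      have h1 := card_union_le X (F₁ ∪ F₂)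
      have h2 := card_union_le F₁ F₂
      omega
    obtain ⟨y, hy, hbal'⟩ := hbal.exists_insert (fun a b => by unfold hitCount; positivity)
      (fun a => by simp [hitCount, hφr]) (sum_hitCount_le hφ) (X ∪ (F₁ ∪ F₂)) subset_union_left
      hFc hα0
    simp only [mem_union, not_or] at hy
    obtain ⟨hyX, hy₁, hy₂⟩ := hy
    have hne : ∀ k < i, Function.update x i y k = x k := fun k hk =>
      Function.update_of_ne hk.ne _ _
    have himage : (range i).image (Function.update x i y) = X :=
      image_congr fun k hk => hne k (by simpa using hk)
    refine ⟨Function.update x i y, ?_, ?_, ?_⟩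
    · rw [range_add_one, coe_insert, Set.injOn_insert (by simp)]
      refine ⟨hinj.congr fun k hk => (hne k (by simpa using hk)).symm, ?_⟩
      rw [← coe_image, himage, Function.update_self]
      exact hyX
    · rw [range_add_one, image_insert, himage, Function.update_self]
      exact hbal'
    · intro p hp q hq hpq k hk
      rw [hne q (by omega)]
      rcases Nat.lt_succ_iff_lt_or_eq.1 hp with hp | rfl
      · rw [hne p hp]
        rcases Nat.lt_succ_iff_lt_or_eq.1 hk with hk | rfl
        · rw [hne k hk]
          exact hfree p hp q hq hpq k hk
        · rw [Function.update_self]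
          exact fun h => hy₁ (mem_biUnion.2 ⟨p, mem_range.2 hp,
            mem_biUnion.2 ⟨q, mem_filter.2 ⟨mem_range.2 hq, hpq⟩, h⟩⟩)
      · rw [Function.update_self]
        rcases Nat.lt_succ_iff_lt_or_eq.1 hk with hk | rfl
        · rw [hne k hk]
          exact fun h => hy₂ (mem_biUnion.2 ⟨q, mem_filter.2 ⟨mem_range.2 hq, hpq⟩,
            mem_biUnion.2 ⟨x k, mem_image_of_mem _ (mem_range.2 hk), by simpa using h⟩⟩)
        · rw [Function.update_self]
          exact hφl _ _

/-! ### Application to edge maps of complete graphs -/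

/-- The endpoints of `f {a, b}`, and nothing if `a = b`. -/
noncomputable def edgeImage {N : ℕ}
    (f : (⊤ : SimpleGraph (Fin N)).edgeSet → (⊤ : SimpleGraph (Fin N)).edgeSet)
    (a b : Fin N) : Finset (Fin N) :=
  if h : a = b then ∅ else (f ⟨s(a, b), h⟩ : Sym2 (Fin N)).toFinset

theorem mem_edgeImage {N : ℕ}
    {f : (⊤ : SimpleGraph (Fin N)).edgeSet → (⊤ : SimpleGraph (Fin N)).edgeSet}
    {a b : Fin N} (h : a ≠ b) (v : Fin N) :
    v ∈ edgeImage f a b ↔ v ∈ (f ⟨s(a, b), h⟩ : Sym2 (Fin N)) := by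
  simp [edgeImage, h]

theorem card_edgeImage_le {N : ℕ}
    (f : (⊤ : SimpleGraph (Fin N)).edgeSet → (⊤ : SimpleGraph (Fin N)).edgeSet)
    (a b : Fin N) : (edgeImage f a b).card ≤ 2 := by
  unfold edgeImage
  split_ifs
  · simp
  · rw [Sym2.card_toFinset]
    split_ifs <;> simp

open Finset in
/-- A graph with `m > 0` edges and no isolated vertices is forced from `8216 m` on. -/
theorem forcesFreeCopy_of_le {V : Type*} [Fintype V] (G : SimpleGraph V)
    [DecidableRel G.Adj] (hG : ∀ v, ¬ G.IsIsolated v) (hm : 0 < #G.edgeFinset) {N : ℕ}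
    (hN : 8216 * #G.edgeFinset ≤ N) : ForcesFreeCopy G N := by
  classical
  intro f hf
  obtain ⟨n, ⟨e₀⟩⟩ := Finite.exists_equiv_fin V
  -- The order dual makes the sort decreasing in degree.
  set σ := Tuple.sort fun i => OrderDual.toDual (G.degree (e₀.symm i))
  have hmono := Tuple.monotone_sort fun i => OrderDual.toDual (G.degree (e₀.symm i))
  set e : Fin n ≃ V := σ.trans e₀.symm
  have hanti : ∀ i j : Fin n, i ≤ j → G.degree (e j) ≤ G.degree (e i) := fun i j hij => hmono hij
  set D : ℕ → ℕ := fun i => if h : i < n then G.degree (e ⟨i, h⟩) else 0 with hDdef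
  set R : ℕ → ℕ → Prop := fun i j => ∃ (hi : i < n) (hj : j < n), G.Adj (e ⟨i, hi⟩) (e ⟨j, hj⟩)
  have hDfin : ∀ i : Fin n, D i = G.degree (e i) := fun i => by simp [hDdef]
  have hDsum : ∑ i ∈ range n, D i = 2 * #G.edgeFinset := by
    rw [← G.sum_degrees_eq_twice_card_edges, ← Fin.sum_univ_eq_sum_range,
      ← Equiv.sum_comp e]
    exact sum_congr rfl fun i _ => hDfin i
  have hDpos : ∀ i ∈ range n, 1 ≤ D i := by
    intro i hi
    have hi := mem_range.1 hi
    rw [hDfin ⟨i, hi⟩, Nat.succ_le_iff, G.degree_pos_iff_exists_adj]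
    simpa [SimpleGraph.IsIsolated] using hG (e ⟨i, hi⟩)
  have hn : n ≤ 2 * #G.edgeFinset := by
    have := sum_le_sum hDpos
    rw [hDsum] at this
    simpa using this
  -- Each of the `i` earlier degrees is at least `D i`, and all degrees sum to `2m`.
  have hDi : ∀ i < n, D i * i ≤ 2 * #G.edgeFinset := by
    intro i hi
    calc D i * i = ∑ j ∈ range i, D i := by simp [mul_comm]
      _ ≤ ∑ j ∈ range i, D j := by
          refine sum_le_sum fun j hj => ?_
          have hj := mem_range.1 hj
          rw [hDfin ⟨i, hi⟩, hDfin ⟨j, hj.trans hi⟩]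
          exact hanti _ _ hj.le
      _ ≤ ∑ j ∈ range n, D j := sum_le_sum_of_subset (range_subset_range.2 hi.le)
      _ = 2 * #G.edgeFinset := hDsum
  have hR : ∀ i < n, #{j ∈ range i | R i j} ≤ D i := by
    intro i hi
    rw [hDfin ⟨i, hi⟩, ← G.card_neighborFinset_eq_degree,
      ← card_map (e.symm.toEmbedding.trans Fin.valEmbedding)]
    refine card_le_card fun j hj => ?_
    obtain ⟨-, _, hj, hadj⟩ := mem_filter.1 hj
    exact mem_map.2 ⟨e ⟨j, hj⟩, by simpa using hadj, by simp⟩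
  have hl : ∀ a b, a ∉ edgeImage f a b := by
    intro a b h
    by_cases hab : a = b
    · simp [edgeImage, hab] at h
    · exact hf _ a ((mem_edgeImage hab a).1 h) (Sym2.mem_mk_left a b)
  have hr : ∀ a b, b ∉ edgeImage f a b := by
    intro a b h
    by_cases hab : a = b
    · simp [edgeImage, hab] at h
    · exact hf _ b ((mem_edgeImage hab b).1 h) (Sym2.mem_mk_right a b)
  obtain ⟨x, hinj, -, hfree⟩ := exists_free_embedding (card_edgeImage_le f) hl hr R D
    (M := 2 * #G.edgeFinset) (by omega) hn hR hDi hDsum.le (by rw [Fintype.card_fin]; omega) n le_rfl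
  have hψ : Function.Injective fun v => x (e.symm v) := by
    intro u v huv
    exact e.symm.injective (Fin.ext (hinj (by simp) (by simp) huv))
  have key : ∀ u v w (hne : x (e.symm u) ≠ x (e.symm v)), G.Adj u v → e.symm v < e.symm u →
      x (e.symm w) ∉ (f ⟨s(x (e.symm u), x (e.symm v)), hne⟩ : Sym2 (Fin N)) := by
    intro u v w hne huv hlt
    rw [← mem_edgeImage hne]
    exact hfree _ (e.symm u).2 _ hlt ⟨(e.symm u).2, (e.symm v).2, by simpa using huv⟩ _
      (e.symm w).2
  let c : SimpleGraph.Copy G (⊤ : SimpleGraph (Fin N)) :=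
    ⟨⟨fun v => x (e.symm v), fun {u v} h => fun h' => h.ne (hψ h')⟩, hψ⟩
  refine ⟨c.toSubgraph, ⟨c.isoToSubgraph⟩, ?_⟩
  rintro ⟨z, hz⟩ hzE a ha haV
  obtain ⟨w, -, rfl⟩ := haV
  induction z using Sym2.ind with
  | _ b₁ b₂ =>
    obtain ⟨u, v, huv, rfl, rfl⟩ := hzE
    have hadj : G.Adj u v := huv
    rcases lt_trichotomy (e.symm u) (e.symm v) with h | h | h
    · refine key v u w (fun h' => hadj.ne (hψ h').symm) hadj.symm h ?_
      convert ha using 3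
      · exact Subtype.ext Sym2.eq_swap
      · rfl
    · exact hadj.ne (e.symm.injective h)
    · exact key u v w (fun h' => hadj.ne (hψ h')) hadj h ha

theorem theorem1 :
    ∃ C : ℝ, 0 < C ∧ ∀ (V : Type*) [Finite V] (G : SimpleGraph V),
      (∀ v : V, ¬ G.IsIsolated v) →
        (forcingThresholds G).Nonempty ∧ (wParam G : ℝ) ≤ C * (G.edgeSet.ncard : ℝ) := by
  refine ⟨8216, by norm_num, fun V _ G hG => ?_⟩
  classical
  have := Fintype.ofFinite V
  have hcard : G.edgeSet.ncard = G.edgeFinset.card := by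
    rw [← SimpleGraph.coe_edgeFinset, Set.ncard_coe_finset]
  have hmem : 8216 * G.edgeFinset.card ∈ forcingThresholds G := by
    intro M hM
    -- Without edges, the absence of isolated vertices leaves only the empty graph, for which
    -- threshold `0` works.
    rcases Nat.eq_zero_or_pos G.edgeFinset.card with h | h
    · have hV : IsEmpty V := by
        refine ⟨fun v => hG v fun w hvw => ?_⟩
        have := Finset.card_pos.2 ⟨s(v, w), SimpleGraph.mem_edgeFinset.2 hvw⟩
        omega
      intro f _
      let c : SimpleGraph.Copy G (⊤ : SimpleGraph (Fin M)) :=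
        ⟨⟨fun v => isEmptyElim v, fun {u} => isEmptyElim u⟩, fun u => isEmptyElim u⟩
      refine ⟨c.toSubgraph, ⟨c.isoToSubgraph⟩, ?_⟩
      rintro _ _ _ _ ⟨w, -⟩
      exact isEmptyElim w
    · exact forcesFreeCopy_of_le G hG h hM
  refine ⟨⟨_, hmem⟩, ?_⟩
  rw [hcard]
  exact_mod_cast Nat.sInf_le hmem
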